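/- Let $p>q$ be primes with $p\equiv 1 \pmod q$, and let $g\in\mathbb Z$ have multiplicative order $q$ modulo $p$. Let $C=C_{pq}$ be the cyclic group of order $pq$ and let $M=M_{pq}=\langle \sigma,\tau \mid \sigma^p=\tau^q=1,\ \tau\sigma\tau^{-1}=\sigma^g\rangle$. Let $G\cong C_{pq}$ be generated by commuting elements $\sigma$ of order $p$ and $\tau$ of order $q$. Let $\lambda:G\to\mathrm{Perm}(G)$ be the left regular representation. A subgroup $N\le \mathrm{Perm}(G)$ is *regular* if it acts simply transitively on $G$, and *$G$-stable* if $\lambda(x)N\lambda(x)^{-1}\subseteq N$ for all $x\in G$. A *skew brace* $(B,\cdot,\circ)$ is a set with two group structures (the dot group and the circle group) such that $x\circ(y\cdot z)=(x\circ y)\cdot x^{-1}\cdot(x\circ z)$ for all $x,y,z$, where $x^{-1}$ is the inverse in the dot group. A regular $G$-stable subgroup $N$ yields the skew brace $(N,\cdot,\circ)$, where $\cdot$ is the operation of $N$ and $\eta\circ\pi=a^{-1}(a(\eta)a(\pi))$, with $a:N\to G$ the bijection $a(\eta)=\eta[1_G]$. Two regular $G$-stable subgroups are *brace equivalent* if they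 yield isomorphic skew braces. For $1\le t\le q-1$ let $N_t=\langle \lambda(\sigma),\pi_t\rangle$, where $\pi_t(\sigma^u\tau^v)=\sigma^{ug^t}\tau^{v-1}$, and let $N_t'$ be the centralizer of $N_t$ in $\mathrm{Perm}(G)$. All $N_t$ and $N_t'$ are regular $G$-stable subgroups of $\mathrm{Perm}(G)$ isomorphic to $M$, and $N_t'=\langle \eta_t,\lambda(\tau)\rangle$, where $\eta_t(\sigma^u\tau^v)=\sigma^{u+g^{-tv}}\tau^v$ (the power $g^{-tv}$ being taken modulo $p$). Moreover: 1. for all $1\le s,t\le q-1$, the subgroups $N_s$ and $N_t$ are brace equivalent, the subgroups $N_s'$ and $N_t'$ are brace equivalent, and $N_s$ and $N_t'$ are not brace equivalent; 2. there are exactly two isomorphism classes of skew braces $(B,\cdot,\circ)$ with $(B,\cdot)\cong M_{pq}$ and $(B,\circ)\cong C_{pq}$. -/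

import Mathlib

universe u v w

/-! ### Skew left braces -/

/-- A skew left brace structure on `B`: two group structures, the dot group and the circle
group, satisfying `x ∘ (y · z) = (x ∘ y) · x⁻¹ · (x ∘ z)`. -/
structure SkewBrace (B : Type u) where
  dot : Group B
  circ : Group B
  brace_rel : ∀ x y z : B, circ.mul x (dot.mul y z) =
    dot.mul (dot.mul (circ.mul x y) (dot.inv x)) (circ.mul x z)

namespace SkewBrace

/-- The dot group `(B, ·)`. -/
def Dot {B : Type u} (_ : SkewBrace B) : Type u := B

/-- The circle group `(B, ∘)`. -/
def Circ {B : Type u} (_ : SkewBrace B) : Type u := B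

instance {B : Type u} (b : SkewBrace B) : Group b.Dot := b.dot

instance {B : Type u} (b : SkewBrace B) : Group b.Circ := b.circ

/-- Two skew left braces are isomorphic if there is a bijection between them that respects
both operations. -/
def Isomorphic {B : Type u} {C : Type v} (b : SkewBrace B) (c : SkewBrace C) : Prop :=
  ∃ e : B ≃ C, (∀ x y, e (b.dot.mul x y) = c.dot.mul (e x) (e y)) ∧
    (∀ x y, e (b.circ.mul x y) = c.circ.mul (e x) (e y))

end SkewBrace

/-- A skew left brace in the universe `u`, bundled with its underlying set. -/
structure BundledBrace : Type (u + 1) where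
  carrier : Type u
  str : SkewBrace carrier

/-- Isomorphism of skew left braces, as an equivalence relation. -/
def braceSetoid : Setoid BundledBrace.{u} where
  r b c := b.str.Isomorphic c.str
  iseqv :=
    { refl := fun _ => ⟨Equiv.refl _, fun _ _ => rfl, fun _ _ => rfl⟩
      symm := by
        rintro b c ⟨e, h1, h2⟩
        refine ⟨e.symm, fun x y => ?_, fun x y => ?_⟩
        · rw [Equiv.symm_apply_eq, h1, e.apply_symm_apply, e.apply_symm_apply]
        · rw [Equiv.symm_apply_eq, h2, e.apply_symm_apply, e.apply_symm_apply]
      trans := by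
        rintro b c d ⟨e, h1, h2⟩ ⟨f, k1, k2⟩
        refine ⟨e.trans f, fun x y => ?_, fun x y => ?_⟩
        · simp only [Equiv.trans_apply, h1, k1]
        · simp only [Equiv.trans_apply, h2, k2] }

/-- The isomorphism classes of the skew left braces whose dot group is isomorphic to `M`
and whose circle group is isomorphic to `C`. -/
def braceClasses (M : Type v) (C : Type w) [Group M] [Group C] :
    Set (Quotient braceSetoid.{u}) :=
  {c | ∃ b : BundledBrace.{u}, Nonempty (b.str.Dot ≃* M) ∧ Nonempty (b.str.Circ ≃* C) ∧
    Quotient.mk braceSetoid b = c}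

/-! ### Regular `G`-stable subgroups of `Perm(G)` and brace equivalence -/

section RegularStable

variable {G : Type u} [Group G]

/-- The left regular representation `λ : G → Perm(G)`, `λ(x)[y] = x * y`. -/
def leftReg (x : G) : Equiv.Perm G := Equiv.mulLeft x

/-- `N` is a regular subgroup of `Perm(G)` (simply transitive on `G`) that is stable under the
action `η ↦ λ(x) η λ(x)⁻¹` of `G`. -/
structure IsRegularStable (N : Subgroup (Equiv.Perm G)) : Prop where
  regular : ∀ x y : G, ∃! η : N, (η : Equiv.Perm G) x = y
  stable : ∀ x : G, ∀ η ∈ N, leftReg x * η * (leftReg x)⁻¹ ∈ N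

/-- The bijection `a : N → G`, `a(η) = η[1]`. -/
noncomputable def IsRegularStable.a {N : Subgroup (Equiv.Perm G)} (h : IsRegularStable N) :
    N ≃ G :=
  Equiv.ofBijective (fun η : N => (η : Equiv.Perm G) 1)
    ((Function.bijective_iff_existsUnique _).2 fun y => h.regular 1 y)

theorem IsRegularStable.a_apply {N : Subgroup (Equiv.Perm G)} (h : IsRegularStable N) (η : N) :
    h.a η = (η : Equiv.Perm G) 1 := rfl

theorem IsRegularStable.circ_eq {N : Subgroup (Equiv.Perm G)} (h : IsRegularStable N)
    (η π : N) : h.a.symm (h.a η * h.a π) =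
      ⟨leftReg (h.a η) * π * (leftReg (h.a η))⁻¹, h.stable _ _ π.2⟩ * η := by
  rw [Equiv.symm_apply_eq, h.a_apply (_ * η)]
  simp only [Subgroup.coe_mul, Equiv.Perm.mul_apply, ← h.a_apply η]
  simp [leftReg, Equiv.Perm.inv_def, h.a_apply π]

/-- The skew left brace `(N, ·, ∘)` given by `N`: the dot operation is that of `N`, and
`η ∘ π = a⁻¹(a(η) a(π))`. -/
noncomputable def IsRegularStable.brace {N : Subgroup (Equiv.Perm G)} (h : IsRegularStable N) :
    SkewBrace N where
  dot := inferInstance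
  circ := h.a.group
  brace_rel := by
    intro x y z
    change h.a.symm (h.a x * h.a (y * z)) =
      h.a.symm (h.a x * h.a y) * x⁻¹ * h.a.symm (h.a x * h.a z)
    rw [h.circ_eq, h.circ_eq, h.circ_eq]
    apply Subtype.ext
    simp [mul_assoc]

/-- Two regular `G`-stable subgroups of `Perm(G)` are brace equivalent if they yield isomorphic
skew left braces. -/
def BraceEquivalent (N N' : Subgroup (Equiv.Perm G)) : Prop :=
  ∃ (h : IsRegularStable N) (h' : IsRegularStable N'), h.brace.Isomorphic h'.brace

/-- The opposite subgroup of `N`: its centralizer in `Perm(G)`. -/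
def oppositeSubgroup (N : Subgroup (Equiv.Perm G)) : Subgroup (Equiv.Perm G) :=
  Subgroup.centralizer (N : Set (Equiv.Perm G))

end RegularStable

/-! ### The groups of order `pq` -/

/-- The metacyclic group `M = ⟨σ, τ | σ ^ p = τ ^ q = 1, τ σ τ⁻¹ = σ ^ g⟩`. -/
abbrev MetacyclicGroup (p q : ℕ) (g : ℤ) : Type :=
  PresentedGroup
    ({FreeGroup.of 0 ^ p, FreeGroup.of 1 ^ q,
      FreeGroup.of 1 * FreeGroup.of 0 * (FreeGroup.of 1)⁻¹ * (FreeGroup.of 0 ^ g)⁻¹} :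
      Set (FreeGroup (Fin 2)))

/-- `G` is generated by commuting elements `σ` of order `p` and `τ` of order `q`. For distinct
primes `p` and `q` this says that `G` is cyclic of order `pq`, described by two generators. -/
structure IsCyclicPQ {G : Type u} [Group G] (p q : ℕ) (σ τ : G) : Prop where
  orderOf_left : orderOf σ = p
  orderOf_right : orderOf τ = q
  rel : τ * σ * τ⁻¹ = σ
  generate : Subgroup.closure {σ, τ} = ⊤

section Families

variable {G : Type u} [Group G] {p q : ℕ} {σ τ : G} {g : ℤ}

theorem IsCyclicPQ.commute (h : IsCyclicPQ p q σ τ) : Commute σ τ := by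
  have := h.rel
  rw [mul_inv_eq_iff_eq_mul] at this
  exact this.symm

theorem IsCyclicPQ.bijective [Fact p.Prime] [Fact q.Prime] (hqp : q < p)
    (h : IsCyclicPQ p q σ τ) :
    Function.Bijective (fun x : ZMod p × ZMod q => σ ^ x.1.val * τ ^ x.2.val) := by
  have hp : p.Prime := Fact.out
  have hq : q.Prime := Fact.out
  have hco : Nat.Coprime p q := (Nat.coprime_primes hp hq).2 hqp.ne'
  have hc := h.commute
  have hord : orderOf (σ * τ) = p * q := by
    rw [hc.orderOf_mul_eq_mul_orderOf_of_coprime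
      (by rw [h.orderOf_left, h.orderOf_right]; exact hco), h.orderOf_left, h.orderOf_right]
  have hσ : ∀ n : ℕ, σ ^ (n : ZMod p).val = σ ^ n := fun n => by
    rw [ZMod.val_natCast, ← h.orderOf_left, pow_mod_orderOf]
  have hτ : ∀ n : ℕ, τ ^ (n : ZMod q).val = τ ^ n := fun n => by
    rw [ZMod.val_natCast, ← h.orderOf_right, pow_mod_orderOf]
  constructor
  · rintro ⟨a, b⟩ ⟨c, d⟩ hx
    change σ ^ a.val * τ ^ b.val = σ ^ c.val * τ ^ d.val at hx
    have h1 := congrArg (fun y => y ^ q) hx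
    have h2 := congrArg (fun y => y ^ p) hx
    simp only [(hc.pow_pow _ _).mul_pow, ← pow_mul] at h1 h2
    rw [pow_eq_one_iff_modEq.2 (show b.val * q ≡ 0 [MOD orderOf τ] by
      rw [h.orderOf_right]; exact Nat.modEq_zero_iff_dvd.2 (dvd_mul_left _ _)),
      pow_eq_one_iff_modEq.2 (show d.val * q ≡ 0 [MOD orderOf τ] by
      rw [h.orderOf_right]; exact Nat.modEq_zero_iff_dvd.2 (dvd_mul_left _ _)),
      mul_one, mul_one, pow_eq_pow_iff_modEq, h.orderOf_left] at h1
    rw [pow_eq_one_iff_modEq.2 (show a.val * p ≡ 0 [MOD orderOf σ] by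
      rw [h.orderOf_left]; exact Nat.modEq_zero_iff_dvd.2 (dvd_mul_left _ _)),
      pow_eq_one_iff_modEq.2 (show c.val * p ≡ 0 [MOD orderOf σ] by
      rw [h.orderOf_left]; exact Nat.modEq_zero_iff_dvd.2 (dvd_mul_left _ _)),
      one_mul, one_mul, pow_eq_pow_iff_modEq, h.orderOf_right] at h2
    have h1' := Nat.ModEq.cancel_right_of_coprime hco h1
    have h2' := Nat.ModEq.cancel_right_of_coprime hco.symm h2
    rw [← ZMod.natCast_eq_natCast_iff, ZMod.natCast_zmod_val, ZMod.natCast_zmod_val] at h1' h2'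
    rw [h1', h2']
  · intro x
    have hx : x ∈ Subgroup.closure {σ, τ} := h.generate ▸ Subgroup.mem_top x
    induction hx using Subgroup.closure_induction with
    | mem y hy =>
      rcases hy with rfl | rfl
      · exact ⟨((1 : ℕ), (0 : ℕ)), by simp only [hσ, hτ]; simp⟩
      · exact ⟨((0 : ℕ), (1 : ℕ)), by simp only [hσ, hτ]; simp⟩
    | one => exact ⟨((0 : ℕ), (0 : ℕ)), by simp only [hσ, hτ]; simp⟩
    | mul y z _ _ hy hz =>
      obtain ⟨⟨a, b⟩, rfl⟩ := hy
      obtain ⟨⟨c, d⟩, rfl⟩ := hz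
      refine ⟨((a.val + c.val : ℕ), (b.val + d.val : ℕ)), ?_⟩
      simp only [hσ, hτ, pow_add]
      rw [mul_assoc, mul_assoc, ← mul_assoc (σ ^ c.val), (hc.pow_pow c.val b.val).eq]
      simp only [mul_assoc]
    | inv y _ hy =>
      obtain ⟨⟨a, b⟩, rfl⟩ := hy
      refine ⟨((p - a.val : ℕ), (q - b.val : ℕ)), ?_⟩
      simp only [hσ, hτ]
      rw [eq_comm, inv_eq_iff_mul_eq_one, mul_assoc, ← mul_assoc (τ ^ b.val),
        ← (hc.pow_pow (p - a.val) b.val).eq, mul_assoc, ← pow_add, ← mul_assoc, ← pow_add,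
        Nat.add_sub_cancel' (ZMod.val_lt a).le, Nat.add_sub_cancel' (ZMod.val_lt b).le,
        ← h.orderOf_left, ← h.orderOf_right, pow_orderOf_eq_one, pow_orderOf_eq_one, one_mul]

/-- The bijection `(u, v) ↦ σ ^ u * τ ^ v` from `ZMod p × ZMod q` to `G`. -/
noncomputable def IsCyclicPQ.coord [Fact p.Prime] [Fact q.Prime] (hqp : q < p)
    (h : IsCyclicPQ p q σ τ) : ZMod p × ZMod q ≃ G :=
  Equiv.ofBijective _ (h.bijective hqp)

theorem IsCyclicPQ.coord_intCast [Fact p.Prime] [Fact q.Prime] (hqp : q < p)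
    (h : IsCyclicPQ p q σ τ) (u v : ℤ) :
    h.coord hqp ((u : ZMod p), (v : ZMod q)) = σ ^ u * τ ^ v := by
  change σ ^ (u : ZMod p).val * τ ^ (v : ZMod q).val = _
  rw [← zpow_natCast, ← zpow_natCast, ZMod.val_intCast, ZMod.val_intCast,
    ← zpow_mod_orderOf σ u, ← zpow_mod_orderOf τ v, h.orderOf_left, h.orderOf_right]

theorem ne_zero_of_orderOf_eq_prime [Fact p.Prime] [Fact q.Prime]
    (hg : orderOf (g : ZMod p) = q) : (g : ZMod p) ≠ 0 := by
  intro h0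
  have := pow_orderOf_eq_one (g : ZMod p)
  rw [hg, h0, zero_pow (Fact.out : q.Prime).ne_zero] at this
  exact zero_ne_one this

/-- The permutation `π_t` of `G`, `π_t(σ ^ u τ ^ v) = σ ^ (u g ^ t) τ ^ (v - 1)`. -/
noncomputable def piPerm [Fact p.Prime] [Fact q.Prime] (hqp : q < p)
    (hG : IsCyclicPQ p q σ τ) (hg : orderOf (g : ZMod p) = q) (t : ℕ) : Equiv.Perm G :=
  (hG.coord hqp).permCongr
    (Equiv.prodCongr
      (Equiv.mulRight₀ ((g : ZMod p) ^ t) (pow_ne_zero t (ne_zero_of_orderOf_eq_prime hg)))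
      (Equiv.subRight (1 : ZMod q)))

/-- The permutation `η_t` of `G`, `η_t(σ ^ u τ ^ v) = σ ^ (u + g ^ (-t v)) τ ^ v`, where the
power `g ^ (-t v)` is taken modulo `p`. -/
noncomputable def etaPerm [Fact p.Prime] [Fact q.Prime] (hqp : q < p)
    (hG : IsCyclicPQ p q σ τ) (g : ℤ) (t : ℕ) : Equiv.Perm G :=
  (hG.coord hqp).permCongr
    { toFun := fun x => (x.1 + (g : ZMod p) ^ (-((t : ℤ) * (x.2.val : ℤ))), x.2)
      invFun := fun x => (x.1 - (g : ZMod p) ^ (-((t : ℤ) * (x.2.val : ℤ))), x.2)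
      left_inv := fun x => by simp
      right_inv := fun x => by simp }

theorem piPerm_apply [Fact p.Prime] [Fact q.Prime] (hqp : q < p)
    (hG : IsCyclicPQ p q σ τ) (hg : orderOf (g : ZMod p) = q) (t : ℕ) (u v : ℤ) :
    piPerm hqp hG hg t (σ ^ u * τ ^ v) = σ ^ (u * g ^ t) * τ ^ (v - 1) := by
  rw [← hG.coord_intCast hqp, ← hG.coord_intCast hqp]
  simp [piPerm, Equiv.permCongr_apply]

theorem etaPerm_apply [Fact p.Prime] [Fact q.Prime] (hqp : q < p)
    (hG : IsCyclicPQ p q σ τ) (hg : orderOf (g : ZMod p) = q) (t : ℕ) (u v c : ℤ)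
    (hc : (c : ZMod p) = (g : ZMod p) ^ (-((t : ℤ) * v))) :
    etaPerm hqp hG g t (σ ^ u * τ ^ v) = σ ^ (u + c) * τ ^ v := by
  have h0 := ne_zero_of_orderOf_eq_prime hg
  have key : (g : ZMod p) ^ (-((t : ℤ) * ((v : ZMod q).val : ℤ))) = (c : ZMod p) := by
    rw [hc, ZMod.val_intCast]
    have h1 : (g : ZMod p) ^ (q : ℤ) = 1 := by
      rw [zpow_natCast, ← hg, pow_orderOf_eq_one]
    conv_rhs => rw [← Int.emod_add_mul_ediv v q]
    rw [show -((t : ℤ) * (v % q + q * (v / q))) = -(t * (v % q)) + q * (-(t * (v / q))) by ring,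
      zpow_add₀ h0, zpow_mul _ (q : ℤ), h1, one_zpow, mul_one]
  rw [← hG.coord_intCast hqp, ← hG.coord_intCast hqp]
  simp only [etaPerm, Equiv.permCongr_apply, Equiv.symm_apply_apply, Equiv.coe_fn_mk, key]
  push_cast
  rfl

/-- The subgroup `N_t = ⟨λ(σ), π_t⟩` of `Perm(G)`. -/
noncomputable def familyN [Fact p.Prime] [Fact q.Prime] (hqp : q < p)
    (hG : IsCyclicPQ p q σ τ) (hg : orderOf (g : ZMod p) = q) (t : ℕ) :
    Subgroup (Equiv.Perm G) :=
  Subgroup.closure {leftReg σ, piPerm hqp hG hg t}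

/-- The subgroup `N_t'`, the opposite of `N_t`. -/
noncomputable def familyN' [Fact p.Prime] [Fact q.Prime] (hqp : q < p)
    (hG : IsCyclicPQ p q σ τ) (hg : orderOf (g : ZMod p) = q) (t : ℕ) :
    Subgroup (Equiv.Perm G) :=
  oppositeSubgroup (familyN hqp hG hg t)

end Families

/-! Everything reduces to one model. For a character `χ` of `ZMod q` with values in `ZMod p`, the
product `(a, b) · (c, d) = (a + χ b * c, b + d)` on `ZMod p × ZMod q`, with addition as circle
operation, is a skew brace. With `χ b = g ^ b`, the left translations of the model for `χ ^ t`,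
carried to `G` by `(u, v) ↦ σ ^ u * τ ^ (-v)`, form `N_t`; the right translations, which are their
centralizer and belong to the opposite brace, form `N_t'`. Under this dictionary brace equivalence
is isomorphism of models (`braceEquivalent_permSubgroup_iff`).

The parameter `t` disappears on rescaling the `ZMod q` coordinate (`isomorphic_mulShift`). The model
is not isomorphic to its opposite: an isomorphism is additive, hence preserves both factors, and
comparing dot products then forces `χ 1 = 1` (`not_isomorphic_op`).

For the count, transport a brace so that its dot group is the model's. Each `λ_x` is then an
automorphism `(a, b) ↦ (r * a + s * (χ b - 1), b)`. As `x ↦ λ_x` is a homomorphism from the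
commutative circle group, these automorphisms commute. Either they share a fixed complement of `ZMod
p`, which gives the model, or all have `r = 1`, which gives the opposite
(`isomorphic_or_isomorphic_op`). -/

namespace SkewBrace

/-! ### Opposites, transport and the lambda map of a skew brace -/

/-- The opposite skew left brace: the dot operation is reversed. -/
def op {B : Type u} (b : SkewBrace B) : SkewBrace B where
  dot := @Group.ofLeftAxioms B ⟨fun x y => b.dot.mul y x⟩ ⟨b.dot.inv⟩ ⟨b.dot.one⟩
    (fun x y z => (mul_assoc (G := b.Dot) z y x).symm) (fun x => mul_one (M := b.Dot) x)
    (fun x => mul_inv_cancel (G := b.Dot) x)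
  circ := b.circ
  brace_rel x y z := by
    let := b.dot
    exact (b.brace_rel x z y).trans (mul_assoc (b.circ.mul x z) x⁻¹ (b.circ.mul x y))

theorem op_dot_mul {B : Type u} (b : SkewBrace B) (x y : B) :
    b.op.dot.mul x y = b.dot.mul y x := rfl

theorem Isomorphic.symm {B : Type u} {C : Type v} {b : SkewBrace B} {c : SkewBrace C}
    (h : b.Isomorphic c) : c.Isomorphic b := by
  obtain ⟨e, h1, h2⟩ := h
  refine ⟨e.symm, fun x y => ?_, fun x y => ?_⟩
  · rw [Equiv.symm_apply_eq, h1, e.apply_symm_apply, e.apply_symm_apply]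
  · rw [Equiv.symm_apply_eq, h2, e.apply_symm_apply, e.apply_symm_apply]

theorem Isomorphic.trans {B : Type u} {C : Type v} {D : Type w} {b : SkewBrace B}
    {c : SkewBrace C} {d : SkewBrace D} (h : b.Isomorphic c) (k : c.Isomorphic d) :
    b.Isomorphic d := by
  obtain ⟨e, h1, h2⟩ := h
  obtain ⟨f, k1, k2⟩ := k
  refine ⟨e.trans f, fun x y => ?_, fun x y => ?_⟩
  · simp only [Equiv.trans_apply, h1, k1]
  · simp only [Equiv.trans_apply, h2, k2]

theorem Isomorphic.op {B : Type u} {C : Type v} {b : SkewBrace B} {c : SkewBrace C}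
    (h : b.Isomorphic c) : b.op.Isomorphic c.op := by
  obtain ⟨e, h1, h2⟩ := h
  exact ⟨e, fun x y => h1 y x, h2⟩

theorem Isomorphic.nonempty_dot {B : Type u} {C : Type v} {b : SkewBrace B} {c : SkewBrace C}
    (h : b.Isomorphic c) : Nonempty (b.Dot ≃* c.Dot) := by
  obtain ⟨e, h1, -⟩ := h
  exact ⟨⟨e, h1⟩⟩

theorem Isomorphic.nonempty_circ {B : Type u} {C : Type v} {b : SkewBrace B} {c : SkewBrace C}
    (h : b.Isomorphic c) : Nonempty (b.Circ ≃* c.Circ) := by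
  obtain ⟨e, -, h2⟩ := h
  exact ⟨⟨e, h2⟩⟩

/-- The dot group of the opposite brace is isomorphic to the dot group by inversion. -/
def opDotEquiv {B : Type u} (b : SkewBrace B) : b.op.Dot ≃* b.Dot where
  toEquiv := Equiv.inv b.Dot
  map_mul' x y := mul_inv_rev (G := b.Dot) y x

/-- The transport of a skew left brace along a bijection. -/
def transport {B : Type u} {C : Type v} (e : C ≃ B) (b : SkewBrace B) : SkewBrace C where
  dot := letI := b.dot; e.group
  circ := letI := b.circ; e.group
  brace_rel x y z := by
    change e.symm (b.circ.mul (e x) (e (e.symm (b.dot.mul (e y) (e z))))) =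
      e.symm (b.dot.mul (e (e.symm (b.dot.mul (e (e.symm (b.circ.mul (e x) (e y))))
        (e (e.symm (b.dot.inv (e x))))))) (e (e.symm (b.circ.mul (e x) (e z)))))
    simp only [e.apply_symm_apply, b.brace_rel]

theorem transport_isomorphic {B : Type u} {C : Type v} (e : C ≃ B) (b : SkewBrace B) :
    (b.transport e).Isomorphic b :=
  ⟨e, fun _ _ => e.apply_symm_apply _, fun _ _ => e.apply_symm_apply _⟩

/-- The map `λ_x(y) = x⁻¹ · (x ∘ y)`. -/
def lam {B : Type u} (b : SkewBrace B) (x y : B) : B :=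
  b.dot.mul (b.dot.inv x) (b.circ.mul x y)

theorem dot_lam {B : Type u} (b : SkewBrace B) (x y : B) :
    b.dot.mul x (b.lam x y) = b.circ.mul x y :=
  mul_inv_cancel_left (G := b.Dot) x (b.circ.mul x y)

/-- This is the brace relation multiplied on the left by `x⁻¹`. With `lam_injective` it makes `λ_x`
an injective endomorphism of the dot group. -/
theorem lam_dot {B : Type u} (b : SkewBrace B) (x y z : B) :
    b.lam x (b.dot.mul y z) = b.dot.mul (b.lam x y) (b.lam x z) := by
  rw [lam, b.brace_rel]
  let := b.dot
  change x⁻¹ * (b.circ.mul x y * x⁻¹ * b.circ.mul x z) =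
    x⁻¹ * b.circ.mul x y * (x⁻¹ * b.circ.mul x z)
  simp only [mul_assoc]

theorem lam_injective {B : Type u} (b : SkewBrace B) (x : B) :
    Function.Injective (b.lam x) := by
  intro y z h
  have h1 : b.circ.mul x y = b.circ.mul x z := by rw [← dot_lam, h, dot_lam]
  exact mul_left_cancel (G := b.Circ) (a := x) h1

/-- Associativity of the circle operation, read through `x ∘ y = x · λ_x(y)`. It makes all `λ_x`
commute when the circle group is commutative. -/
theorem lam_circ {B : Type u} (b : SkewBrace B) (x y z : B) :
    b.lam (b.circ.mul x y) z = b.lam x (b.lam y z) := by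
  have h1 : b.dot.mul (b.circ.mul x y) (b.lam (b.circ.mul x y) z) =
      b.dot.mul (b.circ.mul x y) (b.lam x (b.lam y z)) := by
    calc _ = b.circ.mul (b.circ.mul x y) z := b.dot_lam _ _
      _ = b.circ.mul x (b.circ.mul y z) := mul_assoc (G := b.Circ) x y z
      _ = b.circ.mul x (b.dot.mul y (b.lam y z)) := by rw [dot_lam]
      _ = b.dot.mul x (b.dot.mul (b.lam x y) (b.lam x (b.lam y z))) := by
        rw [← lam_dot, dot_lam, dot_lam]
      _ = b.dot.mul (b.dot.mul x (b.lam x y)) (b.lam x (b.lam y z)) :=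
        (mul_assoc (G := b.Dot) _ _ _).symm
      _ = _ := by rw [dot_lam]
  exact mul_left_cancel (G := b.Dot) h1

/-! ### Skew braces as regular stable subgroups -/

section RegularSubgroup

variable {B : Type u} {G : Type v}

/-- The left regular representation of the dot group of `b`, as permutations of `G`. -/
def permHom (b : SkewBrace B) (a : B ≃ G) : b.Dot →* Equiv.Perm G :=
  (Equiv.permCongrHom (show b.Dot ≃ G from a)).toMonoidHom.comp
    (MulAction.toPermHom b.Dot b.Dot)

/-- The permutation of `G` induced by the left translation by `x` in the dot group. -/
def perm (b : SkewBrace B) (a : B ≃ G) (x : B) : Equiv.Perm G := b.permHom a x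

theorem perm_apply (b : SkewBrace B) (a : B ≃ G) (x y : B) :
    b.perm a x (a y) = a (b.dot.mul x y) := by
  change a (b.dot.mul x (a.symm (a y))) = _
  rw [a.symm_apply_apply]

/-- The image of the left regular representation of the dot group of `b` in `Perm(G)`. -/
def permSubgroup (b : SkewBrace B) (a : B ≃ G) : Subgroup (Equiv.Perm G) :=
  (b.permHom a).range

theorem mem_permSubgroup (b : SkewBrace B) (a : B ≃ G) {η : Equiv.Perm G} :
    η ∈ b.permSubgroup a ↔ ∃ x, b.perm a x = η := Iff.rfl

theorem permHom_injective (b : SkewBrace B) (a : B ≃ G) :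
    Function.Injective (b.permHom a) := by
  intro x y h
  have h1 : b.perm a x (a x) = b.perm a y (a x) := congrArg (fun ρ : Equiv.Perm G => ρ (a x)) h
  erw [perm_apply, perm_apply] at h1
  exact mul_right_cancel (G := b.Dot) (a.injective h1)

/-- The dot group of `b` is isomorphic to its image in `Perm(G)`. -/
noncomputable def permEquiv (b : SkewBrace B) (a : B ≃ G) : b.Dot ≃* b.permSubgroup a :=
  MonoidHom.ofInjective (b.permHom_injective a)

theorem closure_perm_pair (b : SkewBrace B) (a : B ≃ G) {x y : b.Dot}
    (h : Subgroup.closure {x, y} = ⊤) :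
    Subgroup.closure {b.perm a x, b.perm a y} = b.permSubgroup a := by
  rw [permSubgroup, MonoidHom.range_eq_map, ← h, MonoidHom.map_closure, Set.image_pair]
  rfl

/-- A permutation commuting with all left translations is determined by its value at the identity,
so it is a right translation. -/
theorem oppositeSubgroup_permSubgroup (b : SkewBrace B) (a : B ≃ G) :
    oppositeSubgroup (b.permSubgroup a) = b.op.permSubgroup a := by
  ext η
  rw [oppositeSubgroup, Subgroup.mem_centralizer_iff]
  constructor
  · intro h
    refine ⟨a.symm (η (a b.dot.one)), ?_⟩
    change b.op.perm a _ = η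
    ext z
    obtain ⟨z, rfl⟩ := a.surjective z
    have h1 := congrArg (fun ρ : Equiv.Perm G => ρ (a b.dot.one)) (h (b.perm a z) ⟨z, rfl⟩)
    simp only [Equiv.Perm.mul_apply] at h1
    have h2 : b.dot.mul z b.dot.one = z := mul_one (M := b.Dot) z
    rw [b.perm_apply a z b.dot.one, h2] at h1
    obtain ⟨w, hw⟩ := a.surjective (η (a b.dot.one))
    rw [← h1, ← hw, perm_apply, perm_apply, op_dot_mul, a.symm_apply_apply]
  · intro hη ρ hρ
    obtain ⟨y, rfl⟩ := (b.op.mem_permSubgroup a).1 hη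
    obtain ⟨x, rfl⟩ := (b.mem_permSubgroup a).1 hρ
    change b.perm a x * b.op.perm a y = b.op.perm a y * b.perm a x
    ext z
    obtain ⟨z, rfl⟩ := a.surjective z
    rw [Equiv.Perm.mul_apply, Equiv.Perm.mul_apply, perm_apply, perm_apply, perm_apply,
      perm_apply]
    exact congrArg a (mul_assoc (G := b.Dot) x z y).symm

variable [Group G]

/-- The brace relation in operator form; this is what makes the subgroup `G`-stable. -/
theorem leftReg_conj_perm (b : SkewBrace B) {a : B ≃ G}
    (ha : ∀ x y, a (b.circ.mul x y) = a x * a y) (x y : B) :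
    leftReg (a x) * b.perm a y * (leftReg (a x))⁻¹ =
      b.perm a (b.dot.mul (b.circ.mul x y) (b.dot.inv x)) := by
  rw [mul_inv_eq_iff_eq_mul]
  ext z
  obtain ⟨z, rfl⟩ := a.surjective z
  change a x * b.perm a y (a z) = b.perm a _ (a x * a z)
  rw [perm_apply, ← ha, ← ha, perm_apply, b.brace_rel]

theorem isRegularStable_permSubgroup (b : SkewBrace B) {a : B ≃ G}
    (ha : ∀ x y, a (b.circ.mul x y) = a x * a y) : IsRegularStable (b.permSubgroup a) where
  regular x y := by
    obtain ⟨x, rfl⟩ := a.surjective x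
    obtain ⟨y, rfl⟩ := a.surjective y
    refine ⟨⟨b.perm a (b.dot.mul y (b.dot.inv x)), _, rfl⟩, ?_, ?_⟩
    · change b.perm a _ (a x) = a y
      rw [perm_apply]
      exact congrArg a (inv_mul_cancel_right (G := b.Dot) y x)
    · rintro ⟨η, hη⟩ hz
      obtain ⟨z, rfl⟩ := (b.mem_permSubgroup a).1 hη
      apply Subtype.ext
      change b.perm a z (a x) = a y at hz
      change b.perm a z = b.perm a _
      rw [perm_apply] at hz
      rw [← a.injective hz]
      exact congrArg _ (mul_inv_cancel_right (G := b.Dot) z x).symm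
  stable x η := by
    obtain ⟨x, rfl⟩ := a.surjective x
    rintro ⟨y, rfl⟩
    exact ⟨_, (b.leftReg_conj_perm ha x y).symm⟩

theorem circ_one (b : SkewBrace B) : b.circ.one = b.dot.one := by
  have h1 : b.lam b.circ.one b.dot.one = b.dot.one := by
    have h := b.lam_dot b.circ.one b.dot.one b.dot.one
    have h' : b.dot.mul b.dot.one b.dot.one = b.dot.one := one_mul (M := b.Dot) 1
    rw [h'] at h
    exact (left_eq_mul (M := b.Dot)).1 h
  have h2 := b.dot_lam b.circ.one b.dot.one
  have h3 : b.dot.mul b.circ.one b.dot.one = b.circ.one := mul_one (M := b.Dot) b.circ.one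
  have h4 : b.circ.mul b.circ.one b.dot.one = b.dot.one := one_mul (M := b.Circ) b.dot.one
  rwa [h1, h3, h4] at h2

theorem perm_apply_one (b : SkewBrace B) {a : B ≃ G}
    (ha : ∀ x y, a (b.circ.mul x y) = a x * a y) (x : B) : b.perm a x 1 = a x := by
  have h1 : a b.circ.one = 1 := map_one (MonoidHom.mk' (M := b.Circ) (G := G) a ha)
  rw [← h1, perm_apply, circ_one]
  exact congrArg a (mul_one (M := b.Dot) x)

/-- The two group identities coincide, so translation by `x` sends `1` to `a x`. Evaluation at `1`
therefore recovers `a`, and with it the circle operation of `b`. -/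
theorem isomorphic_brace_permSubgroup (b : SkewBrace B) {a : B ≃ G}
    (ha : ∀ x y, a (b.circ.mul x y) = a x * a y) (h : IsRegularStable (b.permSubgroup a)) :
    b.Isomorphic h.brace := by
  refine ⟨(b.permEquiv a).toEquiv, (b.permEquiv a).map_mul, fun x y => ?_⟩
  change _ = h.a.symm (h.a _ * h.a _)
  rw [Equiv.eq_symm_apply]
  change b.perm a (b.circ.mul x y) 1 = b.perm a x 1 * b.perm a y 1
  rw [b.perm_apply_one ha, b.perm_apply_one ha, b.perm_apply_one ha, ha]

end RegularSubgroup

end SkewBrace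

theorem braceEquivalent_permSubgroup_iff {G : Type u} [Group G] {B : Type v} {C : Type w}
    {b : SkewBrace B} {c : SkewBrace C} {a : B ≃ G} {a' : C ≃ G}
    (ha : ∀ x y, a (b.circ.mul x y) = a x * a y)
    (ha' : ∀ x y, a' (c.circ.mul x y) = a' x * a' y) :
    BraceEquivalent (b.permSubgroup a) (c.permSubgroup a') ↔ b.Isomorphic c := by
  constructor
  · rintro ⟨h, h', hi⟩
    exact ((b.isomorphic_brace_permSubgroup ha h).trans hi).trans
      (c.isomorphic_brace_permSubgroup ha' h').symm
  · intro hi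
    exact ⟨b.isRegularStable_permSubgroup ha, c.isRegularStable_permSubgroup ha',
      ((b.isomorphic_brace_permSubgroup ha _).symm.trans hi).trans
        (c.isomorphic_brace_permSubgroup ha' _)⟩

/-! ### The two braces with metacyclic dot group and cyclic circle group -/

/-- The skew left brace on `ZMod p × ZMod q` with
`(a, b) · (c, d) = (a + χ(b) c, b + d)` and componentwise addition as circle operation. -/
def metacyclicBrace {p q : ℕ} (χ : AddChar (ZMod q) (ZMod p)) : SkewBrace (ZMod p × ZMod q) where
  dot := @Group.ofLeftAxioms (ZMod p × ZMod q)
    ⟨fun x y => (x.1 + χ x.2 * y.1, x.2 + y.2)⟩ ⟨fun x => (-(χ (-x.2) * x.1), -x.2)⟩ ⟨(0, 0)⟩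
    (fun x y z => Prod.ext
      (by change x.1 + χ x.2 * y.1 + χ (x.2 + y.2) * z.1 = x.1 + χ x.2 * (y.1 + χ y.2 * z.1)
          rw [AddChar.map_add_eq_mul]; ring) (add_assoc _ _ _))
    (fun x => Prod.ext
      (by change 0 + χ 0 * x.1 = x.1
          rw [AddChar.map_zero_eq_one]; ring) (zero_add _))
    (fun x => Prod.ext (neg_add_cancel (χ (-x.2) * x.1)) (neg_add_cancel x.2))
  circ := inferInstanceAs (Group (Multiplicative (ZMod p × ZMod q)))
  brace_rel x y z := by
    refine Prod.ext ?_ ?_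
    · change x.1 + (y.1 + χ y.2 * z.1) = x.1 + y.1 + χ (x.2 + y.2) * -(χ (-x.2) * x.1) +
        χ (x.2 + y.2 + -x.2) * (x.1 + z.1)
      have h : χ x.2 * χ (-x.2) = 1 := by
        rw [← AddChar.map_add_eq_mul, add_neg_cancel, AddChar.map_zero_eq_one]
      rw [show x.2 + y.2 + -x.2 = y.2 by ring, AddChar.map_add_eq_mul]
      linear_combination (χ y.2 * x.1) * h
    · change x.2 + (y.2 + z.2) = x.2 + y.2 + -x.2 + (x.2 + z.2)
      ring

namespace metacyclicBrace

variable {p q : ℕ} (χ : AddChar (ZMod q) (ZMod p))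

theorem dot_mul (x y : ZMod p × ZMod q) :
    (metacyclicBrace χ).dot.mul x y = (x.1 + χ x.2 * y.1, x.2 + y.2) := rfl

theorem circ_mul (x y : ZMod p × ZMod q) : (metacyclicBrace χ).circ.mul x y = x + y := rfl

theorem circ_mul_op (x y : ZMod p × ZMod q) :
    (metacyclicBrace χ).op.circ.mul x y = x + y := rfl

/-- Multiplication by `t` on the second factor is additive and turns `χ b` into `χ (t * b)`. -/
theorem isomorphic_mulShift [Fact q.Prime] {t : ZMod q} (ht : t ≠ 0) :
    (metacyclicBrace (χ.mulShift t)).Isomorphic (metacyclicBrace χ) := by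
  refine ⟨(Equiv.refl _).prodCongr (Equiv.mulLeft₀ t ht), fun x y => ?_, fun x y => ?_⟩
  · rw [dot_mul, dot_mul]
    refine Prod.ext rfl (mul_add t x.2 y.2)
  · rw [circ_mul, circ_mul]
    refine Prod.ext rfl (mul_add t x.2 y.2)

/-- Serves to recognize `N_t` and `N_t'` from their two generators. -/
theorem eq_top_of_mem (b : SkewBrace (ZMod p × ZMod q))
    (hb : b = metacyclicBrace χ ∨ b = (metacyclicBrace χ).op) (H : Subgroup b.Dot)
    [NeZero p] [NeZero q]
    (h1 : ((1, 0) : ZMod p × ZMod q) ∈ (H : Set b.Dot))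
    (h2 : ((0, 1) : ZMod p × ZMod q) ∈ (H : Set b.Dot)) : H = ⊤ := by
  have hm : ∀ x y : ZMod p × ZMod q, x ∈ (H : Set b.Dot) → y ∈ (H : Set b.Dot) →
      b.dot.mul x y ∈ (H : Set b.Dot) := fun x y hx hy => H.mul_mem hx hy
  have h0 : ((0, 0) : ZMod p × ZMod q) ∈ (H : Set b.Dot) := by
    have := H.one_mem
    rcases hb with rfl | rfl <;> exact this
  have hl : ∀ n : ℕ, (((n : ZMod p), 0) : ZMod p × ZMod q) ∈ (H : Set b.Dot) := by
    intro n
    induction n with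
    | zero => simpa using h0
    | succ n ih =>
      rcases hb with rfl | rfl
      · simpa [dot_mul] using hm _ _ ih h1
      · simpa [SkewBrace.op_dot_mul, dot_mul, add_comm] using hm _ _ ih h1
  have hr : ∀ n : ℕ, ((0, (n : ZMod q)) : ZMod p × ZMod q) ∈ (H : Set b.Dot) := by
    intro n
    induction n with
    | zero => simpa using h0
    | succ n ih =>
      rcases hb with rfl | rfl
      · simpa [dot_mul] using hm _ _ ih h2
      · simpa [SkewBrace.op_dot_mul, dot_mul, add_comm] using hm _ _ ih h2
  refine (Subgroup.eq_top_iff' H).2 fun x => ?_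
  obtain ⟨a, c⟩ := x
  change ((a, c) : ZMod p × ZMod q) ∈ (H : Set b.Dot)
  have ha := hl a.val
  have hc := hr c.val
  rw [ZMod.natCast_zmod_val] at ha hc
  rcases hb with rfl | rfl
  · simpa [dot_mul] using hm _ _ ha hc
  · simpa [SkewBrace.op_dot_mul, dot_mul] using hm _ _ hc ha

theorem circ_equiv (hpq : Nat.Coprime p q) :
    Nonempty ((metacyclicBrace χ).Circ ≃* Multiplicative (ZMod (p * q))) :=
  ⟨(AddEquiv.toMultiplicative (ZMod.chineseRemainder hpq).toAddEquiv).symm⟩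

end metacyclicBrace

/-! ### Additive maps between cyclic groups of prime order -/

theorem natCast_ne_zero_of_primes {p q : ℕ} [Fact p.Prime] [Fact q.Prime] (hpq : p ≠ q) :
    (p : ZMod q) ≠ 0 := by
  rw [Ne, ZMod.natCast_eq_zero_iff]
  exact fun h => hpq ((Nat.prime_dvd_prime_iff_eq Fact.out Fact.out).1 h).symm

/-- An additive map from `ZMod p` to `ZMod q` is trivial for distinct primes `p` and `q`. -/
theorem addMonoidHom_zmod_eq_zero {p q : ℕ} [Fact p.Prime] [Fact q.Prime] (hpq : p ≠ q)
    (f : ZMod p →+ ZMod q) (x : ZMod p) : f x = 0 := by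
  have h : p • f x = 0 := by rw [← map_nsmul, nsmul_eq_mul, CharP.cast_eq_zero, zero_mul, map_zero]
  rw [nsmul_eq_mul] at h
  exact (mul_eq_zero.1 h).resolve_left (natCast_ne_zero_of_primes hpq)

theorem addMonoidHom_zmod_eq_mul {p : ℕ} [NeZero p] (f : ZMod p →+ ZMod p) (x : ZMod p) :
    f x = f 1 * x := by
  conv_lhs => rw [← ZMod.natCast_zmod_val x, ← nsmul_one, map_nsmul, nsmul_eq_mul,
    ZMod.natCast_zmod_val]
  exact mul_comm _ _

/-! ### Classification for commutative circle group -/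

section Classification

variable {p q : ℕ} [Fact p.Prime] [Fact q.Prime] {χ : AddChar (ZMod q) (ZMod p)}

theorem addChar_zmod_ne_zero (b : ZMod q) : χ b ≠ 0 := (χ.val_isUnit b).ne_zero

theorem addChar_zmod_injective (hχ : χ 1 ≠ 1) : Function.Injective χ := by
  intro a b hab
  by_contra hne
  have h0 : a - b ≠ 0 := sub_ne_zero.2 hne
  have h1 : χ (a - b) = 1 := by
    rw [AddChar.map_sub_eq_div, hab, div_self (addChar_zmod_ne_zero b)]
  apply hχ
  -- A nonzero kernel element generates `ZMod q`, so the character would be trivial at `1`.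
  have h2 : (1 : ZMod q) = ((a - b)⁻¹.val) • (a - b) := by
    rw [nsmul_eq_mul, ZMod.natCast_zmod_val, inv_mul_cancel₀ h0]
  rw [h2, AddChar.map_nsmul_eq_pow, h1, one_pow]

namespace metacyclicBrace

theorem not_isomorphic_op (hpq : p ≠ q) (hχ : χ 1 ≠ 1) :
    ¬ (metacyclicBrace χ).Isomorphic (metacyclicBrace χ).op := by
  rintro ⟨e, h1, h2⟩
  let f : ZMod p × ZMod q →+ ZMod p × ZMod q := AddMonoidHom.mk' e h2
  have hl : ∀ a, (e (a, 0)).2 = 0 := addMonoidHom_zmod_eq_zero hpq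
    ((AddMonoidHom.snd _ _).comp (f.comp (AddMonoidHom.inl _ _)))
  have hr : ∀ b, (e (0, b)).1 = 0 := addMonoidHom_zmod_eq_zero hpq.symm
    ((AddMonoidHom.fst _ _).comp (f.comp (AddMonoidHom.inr _ _)))
  -- In the model `(0, 1) · (1, 0) = (χ 1, 1) = (χ 1, 0) ∘ (0, 1)`, whereas the opposite product of
  -- the images has the first coordinate of `e (1, 0)`.
  have h := congrArg Prod.fst (h1 (0, 1) (1, 0))
  have h3 := congrArg Prod.fst (h2 (χ 1, 0) (0, 1))
  simp only [SkewBrace.op_dot_mul, dot_mul, circ_mul, circ_mul_op, hr, Prod.mk_add_mk, add_zero,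
    zero_add, mul_one, mul_zero, Prod.fst_add] at h h3
  rw [h3] at h
  have h4 : e (χ 1, 0) = e (1, 0) := Prod.ext h ((hl _).trans (hl _).symm)
  exact hχ (congrArg Prod.fst (e.injective h4))

/-- The automorphisms of the dot group of `metacyclicBrace χ`. -/
theorem exists_eq_of_map_dot (hpq : p ≠ q) (hχ : χ 1 ≠ 1)
    {f : ZMod p × ZMod q → ZMod p × ZMod q} (hinj : Function.Injective f)
    (hf : ∀ x y, f (x.1 + χ x.2 * y.1, x.2 + y.2) =
      ((f x).1 + χ (f x).2 * (f y).1, (f x).2 + (f y).2)) :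
    ∃ r s : ZMod p, r ≠ 0 ∧ ∀ x, f x = (r * x.1 + s * (χ x.2 - 1), x.2) := by
  have hl2 : ∀ a, (f (a, 0)).2 = 0 := addMonoidHom_zmod_eq_zero hpq
    (AddMonoidHom.mk' (fun a => (f (a, 0)).2) fun a b => by
      simpa using congrArg Prod.snd (hf (a, 0) (b, 0)))
  have hl1 : ∀ a, (f (a, 0)).1 = (f (1, 0)).1 * a := addMonoidHom_zmod_eq_mul
    (AddMonoidHom.mk' (fun a => (f (a, 0)).1) fun a b => by
      simpa [hl2] using congrArg Prod.fst (hf (a, 0) (b, 0)))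
  set r := (f (1, 0)).1 with hr
  have hr0 : r ≠ 0 := by
    intro h
    have h1 : f (1, 0) = f (0, 0) := Prod.ext (by rw [hl1, hl1, h]; ring) (by rw [hl2, hl2])
    exact one_ne_zero (congrArg Prod.fst (hinj h1))
  have hprod : ∀ a b, f (a, b) = (r * a + (f (0, b)).1, (f (0, b)).2) := by
    intro a b
    simpa [hl1 a, hl2] using hf (a, 0) (0, b)
  have hb : ∀ b, (f (0, b)).2 = b := by
    intro b
    -- Since `(0, b) · (1, 0) = (χ b, 0) · (0, b)`, the elements `b` and `(f (0, b)).2` have the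
    -- same value under `χ`, which is injective.
    have h := congrArg Prod.fst (hf (0, b) (1, 0))
    simp only [zero_add, mul_one, add_zero] at h
    rw [hprod] at h
    apply addChar_zmod_injective hχ
    apply mul_left_cancel₀ hr0
    linear_combination -h
  have hχ' : χ 1 - 1 ≠ 0 := sub_ne_zero.2 hχ
  refine ⟨r, (f (0, 1)).1 / (χ 1 - 1), hr0, ?_⟩
  rintro ⟨a, b⟩
  -- Because `(0, b)` and `(0, 1)` commute, the first coordinate of `f (0, b)` is proportional to `χ
  -- b - 1`.
  have h1 := congrArg Prod.fst (hf (0, b) (0, 1))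
  have h2 := congrArg Prod.fst (hf (0, 1) (0, b))
  simp only [zero_add, mul_zero, hb, add_comm 1 b] at h1 h2
  rw [hprod, hb]
  refine Prod.ext ?_ rfl
  change r * a + (f (0, b)).1 = r * a + (f (0, 1)).1 / (χ 1 - 1) * (χ b - 1)
  field_simp
  linear_combination h1 - h2

/-- A skew left brace with commutative circle group whose dot group is that of
`metacyclicBrace χ` is isomorphic to `metacyclicBrace χ` or to its opposite. -/
theorem isomorphic_or_isomorphic_op (hpq : p ≠ q) (hχ : χ 1 ≠ 1)
    (b : SkewBrace (ZMod p × ZMod q))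
    (hdot : ∀ x y, b.dot.mul x y = (x.1 + χ x.2 * y.1, x.2 + y.2))
    (hcomm : ∀ x y, b.circ.mul x y = b.circ.mul y x) :
    b.Isomorphic (metacyclicBrace χ) ∨ b.Isomorphic (metacyclicBrace χ).op := by
  have hχ' : χ 1 - 1 ≠ 0 := sub_ne_zero.2 hχ
  have hex := fun x => exists_eq_of_map_dot hpq hχ (b.lam_injective x)
    (fun y z => by rw [← hdot, b.lam_dot, hdot])
  choose r s hr hlam using hex
  have hcirc : ∀ x y, b.circ.mul x y =
      (x.1 + χ x.2 * (r x * y.1 + s x * (χ y.2 - 1)), x.2 + y.2) := by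
    intro x y
    rw [← b.dot_lam, hdot, hlam]
  have hrs : ∀ x y, (r x - 1) * s y = (r y - 1) * s x := by
    intro x y
    have h : b.lam x (b.lam y (0, 1)) = b.lam y (b.lam x (0, 1)) := by
      rw [← b.lam_circ, hcomm, b.lam_circ]
    simp only [hlam, Prod.mk.injEq, and_true, mul_zero, zero_add] at h
    apply mul_left_cancel₀ hχ'
    linear_combination h
  have hc : ∀ x y : ZMod p × ZMod q, x.1 + χ x.2 * (r x * y.1 + s x * (χ y.2 - 1)) =
      y.1 + χ y.2 * (r y * x.1 + s y * (χ x.2 - 1)) := by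
    intro x y
    have h := congrArg Prod.fst (hcomm x y)
    rwa [hcirc, hcirc] at h
  -- If some `r x ≠ 1`, then `hrs` makes `s` proportional to `r - 1`; otherwise every `λ_x` is
  -- conjugation by an element of `ZMod p × 0`.
  by_cases hr1 : ∃ x, r x ≠ 1
  · obtain ⟨x₀, hx₀⟩ := hr1
    have hx₀' : r x₀ - 1 ≠ 0 := sub_ne_zero.2 hx₀
    obtain ⟨k, hk⟩ : ∃ k, ∀ y, s y = k * (r y - 1) :=
      ⟨s x₀ / (r x₀ - 1), fun y => by field_simp; linear_combination hrs x₀ y⟩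
    -- after the change of coordinates the maps `λ_x` fix the complement `0 × ZMod q`
    have hc' : ∀ x y : ZMod p × ZMod q,
        (χ x.2 * r x - 1) * (y.1 + k * (χ y.2 - 1)) =
          (χ y.2 * r y - 1) * (x.1 + k * (χ x.2 - 1)) := by
      intro x y
      have h := hc x y
      rw [hk x, hk y] at h
      linear_combination h
    have hθ : ∀ x : ZMod p × ZMod q, χ x.2 * r x = 1 := by
      obtain ⟨K, hK⟩ : ∃ K, ∀ x : ZMod p × ZMod q,
          χ x.2 * r x - 1 = K * (x.1 + k * (χ x.2 - 1)) :=
        ⟨_, fun x => by simpa using hc' x (1, 0)⟩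
      -- If `K ≠ 0`, the point `(-K⁻¹, 0)` has `χ = 1` and `r - 1 = -1`, contradicting `r ≠ 0`.
      have hK0 : K = 0 := by
        by_contra hne
        have h := hK (-K⁻¹, 0)
        simp only [AddChar.map_zero_eq_one, sub_self, mul_zero, add_zero, mul_neg,
          mul_inv_cancel₀ hne, one_mul] at h
        exact hr (-K⁻¹, 0) (by linear_combination h)
      intro x
      have h := hK x
      rw [hK0, zero_mul] at h
      exact sub_eq_zero.1 h
    left
    refine ⟨{ toFun := fun x => (x.1 + k * (χ x.2 - 1), x.2)
              invFun := fun x => (x.1 - k * (χ x.2 - 1), x.2)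
              left_inv := fun x => by simp
              right_inv := fun x => by simp }, fun x y => ?_, fun x y => ?_⟩
    · rw [hdot, dot_mul]
      refine Prod.ext ?_ rfl
      simp only [Equiv.coe_fn_mk, AddChar.map_add_eq_mul]
      ring
    · rw [hcirc, circ_mul, hk x]
      refine Prod.ext ?_ rfl
      simp only [Equiv.coe_fn_mk, AddChar.map_add_eq_mul, Prod.fst_add]
      linear_combination (y.1 + k * (χ y.2 - 1)) * hθ x
  · push Not at hr1
    obtain ⟨k, hk⟩ : ∃ k, ∀ x : ZMod p × ZMod q, χ x.2 * s x - x.1 = k * (χ x.2 - 1) := by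
      refine ⟨(χ 1 * s (0, 1)) / (χ 1 - 1), fun x => ?_⟩
      have h := hc x (0, 1)
      simp only [hr1] at h
      field_simp
      linear_combination h
    right
    -- Up to automorphisms of the dot group this is inversion, hence it reverses products. By `hk`
    -- the first coordinate equals `s x`, which is additive for the circle operation.
    refine ⟨{ toFun := fun x => (χ (-x.2) * (x.1 + k * (χ x.2 - 1)), -x.2)
              invFun := fun x => (χ (-x.2) * x.1 - k * (χ (-x.2) - 1), -x.2)
              left_inv := fun x => ?_
              right_inv := fun x => ?_ }, fun x y => ?_, fun x y => ?_⟩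
    · have h : χ x.2 ≠ 0 := addChar_zmod_ne_zero _
      simp only [neg_neg]
      refine Prod.ext ?_ rfl
      simp only [AddChar.map_neg_eq_inv]
      field_simp
      ring
    · have h : χ x.2 ≠ 0 := addChar_zmod_ne_zero _
      simp only [neg_neg]
      refine Prod.ext ?_ rfl
      simp only [AddChar.map_neg_eq_inv]
      field_simp
      ring
    · have hx : χ x.2 ≠ 0 := addChar_zmod_ne_zero _
      have hy : χ y.2 ≠ 0 := addChar_zmod_ne_zero _
      rw [hdot, SkewBrace.op_dot_mul, dot_mul]
      refine Prod.ext ?_ ((neg_add _ _).trans (add_comm _ _))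
      simp only [Equiv.coe_fn_mk, AddChar.map_add_eq_mul, AddChar.map_neg_eq_inv, mul_inv]
      field_simp
      ring
    · have hx : χ x.2 ≠ 0 := addChar_zmod_ne_zero _
      have hy : χ y.2 ≠ 0 := addChar_zmod_ne_zero _
      rw [hcirc, circ_mul_op, hr1]
      refine Prod.ext ?_ (neg_add _ _)
      simp only [Equiv.coe_fn_mk, AddChar.map_add_eq_mul, AddChar.map_neg_eq_inv, mul_inv,
        neg_add, Prod.fst_add]
      field_simp
      linear_combination (χ y.2 - 1) * hk x

end metacyclicBrace

end Classification

/-! ### The metacyclic group in coordinates -/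

section Metacyclic

variable {p q : ℕ} [Fact p.Prime] [Fact q.Prime] {g : ℤ}

/-- The character `b ↦ g ^ b` of `ZMod q` with values in `ZMod p`. -/
noncomputable def powChar (hg : orderOf (g : ZMod p) = q) : AddChar (ZMod q) (ZMod p) :=
  AddChar.zmodChar q (ζ := (g : ZMod p)) (by rw [← hg]; exact pow_orderOf_eq_one _)

theorem powChar_natCast (hg : orderOf (g : ZMod p) = q) (n : ℕ) :
    powChar hg n = (g : ZMod p) ^ n :=
  AddChar.zmodChar_apply' _ n

theorem powChar_one_ne_one (hg : orderOf (g : ZMod p) = q) : powChar hg 1 ≠ 1 := by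
  have h := powChar_natCast hg 1
  rw [Nat.cast_one, pow_one] at h
  rw [h]
  intro h1
  rw [h1, orderOf_one] at hg
  exact (Fact.out : q.Prime).ne_one hg.symm

/-- The metacyclic group is the dot group of `metacyclicBrace (powChar hg)`. -/
theorem nonempty_metacyclicGroup_equiv (hg : orderOf (g : ZMod p) = q) :
    Nonempty ((metacyclicBrace (powChar hg)).Dot ≃* MetacyclicGroup p q g) := by
  set D := (metacyclicBrace (powChar hg)).Dot
  let mk : ZMod p × ZMod q → D := fun x => x
  have hmul : ∀ x y, mk x * mk y = mk (x.1 + powChar hg x.2 * y.1, x.2 + y.2) := fun _ _ => rfl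
  let s : D := mk (1, 0)
  let t : D := mk (0, 1)
  have hs : ∀ n : ℕ, s ^ n = mk ((n : ZMod p), 0) := by
    intro n
    induction n with
    | zero => rw [pow_zero, Nat.cast_zero]; rfl
    | succ n ih => rw [pow_succ, ih, hmul]; simp
  have ht : ∀ n : ℕ, t ^ n = mk (0, (n : ZMod q)) := by
    intro n
    induction n with
    | zero => rw [pow_zero, Nat.cast_zero]; rfl
    | succ n ih => rw [pow_succ, ih, hmul]; simp
  have hsp : s ^ p = 1 := by rw [hs, CharP.cast_eq_zero]; rfl
  have htq : t ^ q = 1 := by rw [ht, CharP.cast_eq_zero]; rfl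
  -- A natural representative of `g` modulo `p` allows the commutation rule for powers to be proved
  -- by induction.
  obtain ⟨m, hm⟩ : ∃ m : ℕ, (m : ZMod p) = (g : ZMod p) :=
    ⟨(g : ZMod p).val, ZMod.natCast_zmod_val _⟩
  have hgpow : ∀ {H : Type} [Group H] (x : H), x ^ p = 1 → x ^ g = x ^ m := by
    intro H _ x hx
    have h1 : (p : ℤ) ∣ m - g := by
      rw [← ZMod.intCast_zmod_eq_zero_iff_dvd]
      push_cast
      rw [hm, sub_self]
    obtain ⟨k, hk⟩ := h1
    have h2 : (m : ℤ) = g + p * k := by omega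
    rw [← zpow_natCast x m, h2, zpow_add, zpow_mul, zpow_natCast, hx, one_zpow, mul_one]
  have hrel : t * s * t⁻¹ * (s ^ g)⁻¹ = 1 := by
    rw [hgpow s hsp, mul_inv_eq_one, mul_inv_eq_iff_eq_mul, hs, hmul, hmul]
    have h := powChar_natCast hg 1
    rw [Nat.cast_one, pow_one] at h
    simp [h, hm]
  let f : MetacyclicGroup p q g →* D := PresentedGroup.toGroup (f := ![s, t]) (by
    rintro r (rfl | rfl | rfl)
    · simpa using hsp
    · simpa using htq
    · simpa using hrel)
  let σ : MetacyclicGroup p q g := PresentedGroup.of 0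
  let τ : MetacyclicGroup p q g := PresentedGroup.of 1
  have hfσ : f σ = s := PresentedGroup.toGroup.of _
  have hfτ : f τ = t := PresentedGroup.toGroup.of _
  have hσ : σ ^ p = 1 := PresentedGroup.one_of_mem (Or.inl rfl)
  have hτ : τ ^ q = 1 := PresentedGroup.one_of_mem (Or.inr (Or.inl rfl))
  have hστ : τ * σ * τ⁻¹ = σ ^ m := by
    rw [← hgpow σ hσ, ← mul_inv_eq_one]
    exact PresentedGroup.one_of_mem (Or.inr (Or.inr rfl))
  have hσn : ∀ n : ℕ, σ ^ (n : ZMod p).val = σ ^ n := fun n => by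
    rw [ZMod.val_natCast, ← pow_eq_pow_mod n hσ]
  have hτn : ∀ n : ℕ, τ ^ (n : ZMod q).val = τ ^ n := fun n => by
    rw [ZMod.val_natCast, ← pow_eq_pow_mod n hτ]
  have hcomm : ∀ b c : ℕ, τ ^ b * σ ^ c = σ ^ (m ^ b * c) * τ ^ b := by
    intro b
    induction b with
    | zero => intro c; simp
    | succ b ih =>
      intro c
      have h : τ * σ ^ c = σ ^ (m * c) * τ := by
        rw [pow_mul, ← hστ, conj_pow, inv_mul_cancel_right]
      rw [pow_succ, mul_assoc, h, ← mul_assoc, ih, mul_assoc, ← mul_assoc (m ^ b), ← pow_succ]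
  -- The normal form `σ ^ a * τ ^ b` gives an explicit inverse of `f`, so the order of the presented
  -- group need not be computed.
  let k : D →* MetacyclicGroup p q g := MonoidHom.mk'
    (fun x : ZMod p × ZMod q => σ ^ x.1.val * τ ^ x.2.val) (by
      intro x y
      obtain ⟨a, b⟩ := x
      obtain ⟨c, d⟩ := y
      obtain ⟨a, rfl⟩ := ZMod.natCast_zmod_surjective a
      obtain ⟨b, rfl⟩ := ZMod.natCast_zmod_surjective b
      obtain ⟨c, rfl⟩ := ZMod.natCast_zmod_surjective c
      obtain ⟨d, rfl⟩ := ZMod.natCast_zmod_surjective d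
      change σ ^ ((a : ZMod p) + powChar hg b * c).val * τ ^ ((b : ZMod q) + d).val =
        σ ^ (a : ZMod p).val * τ ^ (b : ZMod q).val * (σ ^ (c : ZMod p).val * τ ^ (d : ZMod q).val)
      rw [powChar_natCast, ← hm]
      have h1 : (a : ZMod p) + (m : ZMod p) ^ b * c = ((a + m ^ b * c : ℕ) : ZMod p) := by
        push_cast; rfl
      rw [h1, ← Nat.cast_add, hσn, hτn, hσn, hτn, hσn, hτn, pow_add, pow_add,
        mul_assoc (σ ^ a) (τ ^ b), ← mul_assoc (τ ^ b), hcomm]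
      simp only [mul_assoc])
  have hk : ∀ x : ZMod p × ZMod q, k x = σ ^ x.1.val * τ ^ x.2.val := fun _ => rfl
  refine ⟨MulEquiv.symm (MonoidHom.toMulEquiv f k ?_ ?_)⟩
  · apply PresentedGroup.ext
    intro i
    have h01 : (0 : ZMod p) = (0 : ℕ) ∧ (0 : ZMod q) = (0 : ℕ) := by simp
    have h11 : (1 : ZMod p) = (1 : ℕ) ∧ (1 : ZMod q) = (1 : ℕ) := by simp
    fin_cases i
    · change k (f σ) = σ
      rw [hfσ, hk]
      change σ ^ (1 : ZMod p).val * τ ^ (0 : ZMod q).val = σ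
      rw [h01.2, h11.1, hσn, hτn, pow_one, pow_zero, mul_one]
    · change k (f τ) = τ
      rw [hfτ, hk]
      change σ ^ (0 : ZMod p).val * τ ^ (1 : ZMod q).val = τ
      rw [h01.1, h11.2, hσn, hτn, pow_one, pow_zero, one_mul]
  · ext x : 1
    obtain ⟨x, rfl⟩ : ∃ y, mk y = x := ⟨x, rfl⟩
    change f (σ ^ x.1.val * τ ^ x.2.val) = mk x
    rw [map_mul, map_pow, map_pow, hfσ, hfτ, hs, ht, hmul]
    simp [AddChar.map_zero_eq_one]

end Metacyclic

/-! ### The two families -/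

section Families

variable {G : Type u} [Group G] {p q : ℕ} [Fact p.Prime] [Fact q.Prime] {σ τ : G} {g : ℤ}

theorem IsCyclicPQ.coord_add (hqp : q < p) (hG : IsCyclicPQ p q σ τ) (x y : ZMod p × ZMod q) :
    hG.coord hqp (x + y) = hG.coord hqp x * hG.coord hqp y := by
  obtain ⟨a, b⟩ := x
  obtain ⟨c, d⟩ := y
  obtain ⟨a, rfl⟩ := ZMod.intCast_surjective a
  obtain ⟨b, rfl⟩ := ZMod.intCast_surjective b
  obtain ⟨c, rfl⟩ := ZMod.intCast_surjective c
  obtain ⟨d, rfl⟩ := ZMod.intCast_surjective d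
  rw [Prod.mk_add_mk, ← Int.cast_add, ← Int.cast_add, hG.coord_intCast, hG.coord_intCast,
    hG.coord_intCast, zpow_add, zpow_add, mul_assoc, mul_assoc, ← mul_assoc (σ ^ c),
    (hG.commute.zpow_zpow c b).eq]
  simp only [mul_assoc]

theorem IsCyclicPQ.left_mul_coord (hqp : q < p) (hG : IsCyclicPQ p q σ τ)
    (x : ZMod p × ZMod q) : σ * hG.coord hqp x = hG.coord hqp ((1, 0) + x) := by
  have h : hG.coord hqp (1, 0) = σ := by simpa using hG.coord_intCast hqp 1 0
  rw [hG.coord_add, h]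

theorem IsCyclicPQ.right_mul_coord (hqp : q < p) (hG : IsCyclicPQ p q σ τ)
    (x : ZMod p × ZMod q) : τ * hG.coord hqp x = hG.coord hqp ((0, 1) + x) := by
  have h : hG.coord hqp (0, 1) = τ := by simpa using hG.coord_intCast hqp 0 1
  rw [hG.coord_add, h]

/-- The bijection `(u, v) ↦ σ ^ u * τ ^ (-v)` from `ZMod p × ZMod q` to `G`. -/
noncomputable def IsCyclicPQ.negCoord (hqp : q < p) (hG : IsCyclicPQ p q σ τ) :
    ZMod p × ZMod q ≃ G :=
  ((Equiv.refl _).prodCongr (Equiv.neg _)).trans (hG.coord hqp)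

theorem IsCyclicPQ.negCoord_apply (hqp : q < p) (hG : IsCyclicPQ p q σ τ)
    (x : ZMod p × ZMod q) : hG.negCoord hqp x = hG.coord hqp (x.1, -x.2) := rfl

theorem IsCyclicPQ.negCoord_add (hqp : q < p) (hG : IsCyclicPQ p q σ τ)
    (x y : ZMod p × ZMod q) :
    hG.negCoord hqp (x + y) = hG.negCoord hqp x * hG.negCoord hqp y := by
  rw [hG.negCoord_apply, hG.negCoord_apply, hG.negCoord_apply, ← hG.coord_add]
  exact congrArg _ (Prod.ext rfl (neg_add _ _))

/-- The skew left brace on `ZMod p × ZMod q` that corresponds to `N_t`. -/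
noncomputable abbrev familyBrace (hg : orderOf (g : ZMod p) = q) (t : ℕ) :
    SkewBrace (ZMod p × ZMod q) :=
  metacyclicBrace ((powChar hg).mulShift (t : ZMod q))

/-- Left translation by `(1, 0)` is `λ(σ)`. Left translation by `(0, 1)` multiplies `u` by `g ^ t`
and raises the second coordinate; the sign in `negCoord` turns this into `τ ^ (v - 1)`, so it is
`π_t`. -/
theorem familyN_eq (hqp : q < p) (hG : IsCyclicPQ p q σ τ) (hg : orderOf (g : ZMod p) = q)
    (t : ℕ) :
    familyN hqp hG hg t = (familyBrace hg t).permSubgroup (hG.negCoord hqp) := by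
  let mk : ZMod p × ZMod q → (familyBrace hg t).Dot := fun x => x
  have h1 : mk (1, 0) ∈ Subgroup.closure {mk (1, 0), mk (0, 1)} :=
    Subgroup.subset_closure (Or.inl rfl)
  have h2 : mk (0, 1) ∈ Subgroup.closure {mk (1, 0), mk (0, 1)} :=
    Subgroup.subset_closure (Or.inr rfl)
  have htop := metacyclicBrace.eq_top_of_mem _ _ (Or.inl rfl) _ h1 h2
  rw [familyN, ← (familyBrace hg t).closure_perm_pair (hG.negCoord hqp) htop]
  congr 2
  · ext z
    obtain ⟨⟨a, b⟩, rfl⟩ := (hG.negCoord hqp).surjective z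
    rw [SkewBrace.perm_apply, metacyclicBrace.dot_mul]
    change σ * _ = _
    rw [hG.negCoord_apply, hG.negCoord_apply, hG.left_mul_coord]
    simp
  · congr 1
    ext z
    obtain ⟨⟨a, b⟩, rfl⟩ := (hG.negCoord hqp).surjective z
    rw [SkewBrace.perm_apply, metacyclicBrace.dot_mul, hG.negCoord_apply, hG.negCoord_apply]
    simp only [piPerm, Equiv.permCongr_apply, Equiv.symm_apply_apply, AddChar.mulShift_apply,
      mul_one, powChar_natCast]
    refine congrArg _ (Prod.ext ?_ ?_)
    · simp [mul_comm]
    · simp [sub_eq_add_neg, add_comm]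

theorem familyN'_eq (hqp : q < p) (hG : IsCyclicPQ p q σ τ) (hg : orderOf (g : ZMod p) = q)
    (t : ℕ) :
    familyN' hqp hG hg t = (familyBrace hg t).op.permSubgroup (hG.negCoord hqp) := by
  rw [familyN', familyN_eq, SkewBrace.oppositeSubgroup_permSubgroup]

theorem powChar_mulShift_neg (hg : orderOf (g : ZMod p) = q) (t : ℕ) (v : ZMod q) :
    (powChar hg).mulShift (t : ZMod q) (-v) = (g : ZMod p) ^ (-((t : ℤ) * (v.val : ℤ))) := by
  have h : (t : ZMod q) * v = ((t * v.val : ℕ) : ZMod q) := by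
    push_cast
    rw [ZMod.natCast_zmod_val]
  rw [AddChar.mulShift_apply, mul_neg, AddChar.map_neg_eq_inv, h, powChar_natCast, zpow_neg,
    ← zpow_natCast, Nat.cast_mul]

theorem closure_etaPerm_leftReg (hqp : q < p) (hG : IsCyclicPQ p q σ τ)
    (hg : orderOf (g : ZMod p) = q) (t : ℕ) :
    familyN' hqp hG hg t = Subgroup.closure {etaPerm hqp hG g t, leftReg τ} := by
  let mk : ZMod p × ZMod q → (familyBrace hg t).op.Dot := fun x => x
  have h1 : mk (1, 0) ∈ Subgroup.closure {mk (1, 0), mk (0, -1)} :=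
    Subgroup.subset_closure (Or.inl rfl)
  have h2 : mk (0, -1) ∈ Subgroup.closure {mk (1, 0), mk (0, -1)} :=
    Subgroup.subset_closure (Or.inr rfl)
  -- Under `negCoord`, right translation by `(0, -1)` is `λ(τ)`, while the generation criterion asks
  -- for its inverse `(0, 1)`.
  have hinv : (mk (0, -1))⁻¹ = mk (0, 1) := by
    refine Prod.ext ?_ (neg_neg (1 : ZMod q))
    change -(_ * (0 : ZMod p)) = 0
    rw [mul_zero, neg_zero]
  have h3 := Subgroup.inv_mem _ h2
  rw [hinv] at h3
  have htop := metacyclicBrace.eq_top_of_mem _ _ (Or.inr rfl) _ h1 h3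
  rw [familyN'_eq, ← (familyBrace hg t).op.closure_perm_pair (hG.negCoord hqp) htop]
  congr 2
  · ext z
    obtain ⟨⟨a, b⟩, rfl⟩ := (hG.coord hqp).surjective z
    have hz : hG.coord hqp (a, b) = hG.negCoord hqp (a, -b) := by
      rw [hG.negCoord_apply, neg_neg]
    conv_lhs => rw [hz]
    rw [SkewBrace.perm_apply, SkewBrace.op_dot_mul, metacyclicBrace.dot_mul, hG.negCoord_apply]
    simp only [etaPerm, Equiv.permCongr_apply, Equiv.symm_apply_apply, Equiv.coe_fn_mk,
      ← powChar_mulShift_neg hg t b]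
    simp
  · congr 1
    ext z
    obtain ⟨⟨a, b⟩, rfl⟩ := (hG.negCoord hqp).surjective z
    rw [SkewBrace.perm_apply, SkewBrace.op_dot_mul, metacyclicBrace.dot_mul]
    change _ = τ * _
    rw [hG.negCoord_apply, hG.negCoord_apply, hG.right_mul_coord]
    simp [add_comm]

theorem natCast_zmod_ne_zero_of_mem_Icc {t : ℕ} (ht : t ∈ Finset.Icc 1 (q - 1)) :
    (t : ZMod q) ≠ 0 := by
  have hq := (Fact.out : q.Prime).pos
  rw [Finset.mem_Icc] at ht
  rw [Ne, ZMod.natCast_eq_zero_iff]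
  exact fun h => absurd (Nat.le_of_dvd (by omega) h) (by omega)

end Families

/-! ### Isomorphism classes -/

/-- An isomorphism of dot groups moves any such brace onto the model's underlying set; of the circle
group only commutativity is then used. `Equiv.ulift` places the two models in the required universe.
-/
theorem braceClasses_eq_pair {p q : ℕ} [Fact p.Prime] [Fact q.Prime] (hpq : p ≠ q) {g : ℤ}
    (hg : orderOf (g : ZMod p) = q) :
    braceClasses.{v} (MetacyclicGroup p q g) (Multiplicative (ZMod (p * q))) =
      {Quotient.mk braceSetoid ⟨_, (metacyclicBrace (powChar hg)).transport Equiv.ulift⟩,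
        Quotient.mk braceSetoid ⟨_, (metacyclicBrace (powChar hg)).op.transport Equiv.ulift⟩} := by
  obtain ⟨eM⟩ := nonempty_metacyclicGroup_equiv hg
  obtain ⟨eC⟩ := metacyclicBrace.circ_equiv (powChar hg)
    ((Nat.coprime_primes Fact.out Fact.out).2 hpq)
  ext c
  constructor
  · rintro ⟨⟨B, b⟩, ⟨f⟩, ⟨k⟩, rfl⟩
    let e : B ≃ ZMod p × ZMod q := (f.trans eM.symm).toEquiv
    have he : ∀ x y : B, e (b.dot.mul x y) = (metacyclicBrace (powChar hg)).dot.mul (e x) (e y) :=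
      (f.trans eM.symm).map_mul
    have hi := b.transport_isomorphic e.symm
    have hor := metacyclicBrace.isomorphic_or_isomorphic_op hpq (powChar_one_ne_one hg)
      (b.transport e.symm)
      (fun x y => by
        change e (b.dot.mul (e.symm x) (e.symm y)) = _
        rw [he, e.apply_symm_apply, e.apply_symm_apply, metacyclicBrace.dot_mul])
      (fun x y => by
        change e (b.circ.mul (e.symm x) (e.symm y)) = e (b.circ.mul (e.symm y) (e.symm x))
        refine congrArg e (k.injective ?_)
        exact (k.map_mul _ _).trans ((mul_comm _ _).trans (k.map_mul _ _).symm))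
    refine hor.imp (fun h => ?_) (fun h => ?_)
    · exact Quotient.sound ((hi.symm.trans h).trans
        (SkewBrace.transport_isomorphic Equiv.ulift _).symm)
    · exact Quotient.sound ((hi.symm.trans h).trans
        (SkewBrace.transport_isomorphic Equiv.ulift _).symm)
  · have hmem : ∀ b : SkewBrace (ZMod p × ZMod q),
        Nonempty (b.Dot ≃* MetacyclicGroup p q g) →
        Nonempty (b.Circ ≃* Multiplicative (ZMod (p * q))) →
        Quotient.mk braceSetoid ⟨_, b.transport Equiv.ulift.{v}⟩ ∈
          braceClasses.{v} (MetacyclicGroup p q g) (Multiplicative (ZMod (p * q))) := by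
      rintro b ⟨e⟩ ⟨e'⟩
      have h := b.transport_isomorphic Equiv.ulift.{v}
      exact ⟨_, ⟨h.nonempty_dot.some.trans e⟩, ⟨h.nonempty_circ.some.trans e'⟩, rfl⟩
    rintro (rfl | rfl)
    · exact hmem _ ⟨eM⟩ ⟨eC⟩
    -- Passing to the opposite leaves the circle group unchanged, and inversion identifies the dot
    -- groups.
    · exact hmem _ ⟨(SkewBrace.opDotEquiv _).trans eM⟩ ⟨eC⟩

theorem encard_braceClasses {p q : ℕ} [Fact p.Prime] [Fact q.Prime] (hpq : p ≠ q) {g : ℤ}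
    (hg : orderOf (g : ZMod p) = q) :
    (braceClasses.{v} (MetacyclicGroup p q g) (Multiplicative (ZMod (p * q)))).encard = 2 := by
  rw [braceClasses_eq_pair hpq hg]
  refine Set.encard_pair fun h => ?_
  have h1 : ((metacyclicBrace (powChar hg)).transport Equiv.ulift.{v}).Isomorphic
    ((metacyclicBrace (powChar hg)).op.transport Equiv.ulift.{v}) := Quotient.exact h
  exact metacyclicBrace.not_isomorphic_op hpq (powChar_one_ne_one hg)
    (((SkewBrace.transport_isomorphic _ _).symm.trans h1).trans
      (SkewBrace.transport_isomorphic _ _))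

theorem mainTheorem4 {G : Type u} [Group G] {p q : ℕ} [Fact p.Prime] [Fact q.Prime]
    (hqp : q < p) (hmod : p ≡ 1 [MOD q])
    {g : ℤ} (hg : orderOf (g : ZMod p) = q)
    {σ τ : G} (hG : IsCyclicPQ p q σ τ) :
    -- the members of both families are regular `G`-stable subgroups isomorphic to `M`
    (∀ t ∈ Finset.Icc 1 (q - 1),
      (IsRegularStable (familyN hqp hG hg t) ∧
        Nonempty (familyN hqp hG hg t ≃* MetacyclicGroup p q g)) ∧
      (IsRegularStable (familyN' hqp hG hg t) ∧
        Nonempty (familyN' hqp hG hg t ≃* MetacyclicGroup p q g)) ∧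
      familyN' hqp hG hg t = Subgroup.closure {etaPerm hqp hG g t, leftReg τ}) ∧
    -- brace equivalence within and between the families
    (∀ s ∈ Finset.Icc 1 (q - 1), ∀ t ∈ Finset.Icc 1 (q - 1),
      BraceEquivalent (familyN hqp hG hg s) (familyN hqp hG hg t) ∧
      BraceEquivalent (familyN' hqp hG hg s) (familyN' hqp hG hg t) ∧
      ¬ BraceEquivalent (familyN hqp hG hg s) (familyN' hqp hG hg t)) ∧
    -- there are exactly two isomorphism classes of skew left braces of this kind
    (braceClasses.{v} (MetacyclicGroup p q g) (Multiplicative (ZMod (p * q)))).encard = 2 := by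
  have hpq : p ≠ q := hqp.ne'
  have hχ := powChar_one_ne_one hg
  obtain ⟨eM⟩ := nonempty_metacyclicGroup_equiv hg
  have ha := hG.negCoord_add hqp
  have hiso : ∀ t ∈ Finset.Icc 1 (q - 1),
      (familyBrace hg t).Isomorphic (metacyclicBrace (powChar hg)) := fun t ht =>
    metacyclicBrace.isomorphic_mulShift _ (natCast_zmod_ne_zero_of_mem_Icc ht)
  refine ⟨fun t ht => ?_, fun s hs t ht => ?_, encard_braceClasses hpq hg⟩
  · obtain ⟨e⟩ := (hiso t ht).nonempty_dot
    refine ⟨?_, ?_, closure_etaPerm_leftReg hqp hG hg t⟩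
    · rw [familyN_eq]
      exact ⟨SkewBrace.isRegularStable_permSubgroup _ ha,
        ⟨((SkewBrace.permEquiv _ _).symm.trans e).trans eM⟩⟩
    · rw [familyN'_eq]
      exact ⟨SkewBrace.isRegularStable_permSubgroup _ ha,
        ⟨(((SkewBrace.permEquiv _ _).symm.trans (SkewBrace.opDotEquiv _)).trans e).trans eM⟩⟩
  · rw [familyN_eq, familyN_eq, familyN'_eq, familyN'_eq,
      braceEquivalent_permSubgroup_iff ha ha, braceEquivalent_permSubgroup_iff ha ha,
      braceEquivalent_permSubgroup_iff ha ha]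
    exact ⟨(hiso s hs).trans (hiso t ht).symm, ((hiso s hs).trans (hiso t ht).symm).op,
      fun h => metacyclicBrace.not_isomorphic_op hpq hχ
        (((hiso s hs).symm.trans h).trans (hiso t ht).op)⟩
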